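/- For a totally real number field $F$ with ring of integers $\mathcal O_F$, let $\mathcal O_F^+$ be the set of $\alpha\in\mathcal O_F$ with $\sigma(\alpha)>0$ for every embedding $\sigma:F\hookrightarrow\mathbb R$. An element $\alpha\in\mathcal O_F^+$ is indecomposable if it cannot be written as $\alpha=\beta+\gamma$ with $\beta,\gamma\in\mathcal O_F^+$. A real biquadratic field is a field $K=\mathbb Q(\sqrt p,\sqrt q)$ with $[K:\mathbb Q]=4$, where $p,q$ are squarefree positive integers. **Theorem.** (a) Let $K$ be a real biquadratic field. Then $K$ has exactly three quadratic subfields, and for at least two of them, say $F$, every indecomposable element of $\mathcal O_F^+$ remains indecomposable in $\mathcal O_K^+$. (b) Explicitly, let $p,q$ be squarefree positive integers such that $K=\mathbb Q(\sqrt p,\sqrt q)$ has degree $4$ over $\mathbb Q$, and put $r=pq/\gcd(p,q)^2$, $K_p=\mathbb Q(\sqrt p)$, $K_q=\mathbb Q(\sqrt q)$. Consider the types 1. $p\equiv2$, $q\equiv3\pmod 4$; 2. $p\equiv 2$ or $3$, $q\equiv1\pmod 4$; 3. $p\equiv q\equiv1\pmod 4$ and $\gcd(p,q)\equiv1\pmod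 4$; 4. $p\equiv q\equiv1\pmod 4$ and $\gcd(p,q)\equiv3\pmod 4$. If $(p,q)$ is of type 1 or 2 and $p<r$, or if $(p,q)$ is of type 3 or 4 and $p<q<r$, then every indecomposable element of $\mathcal O_{K_p}^+$ and every indecomposable element of $\mathcal O_{K_q}^+$ remains indecomposable in $\mathcal O_K^+$. -/

import Mathlib

/-- An element `α` of a (totally real number) field `F` is totally positive if `σ α > 0` for
every embedding `σ : F → ℝ`. -/
def IsTotallyPositive {F : Type*} [Field F] (α : F) : Prop :=
  ∀ σ : F →+* ℝ, 0 < σ α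

/-- `α` is an indecomposable element of `𝓞_F⁺`: it is a totally positive algebraic integer of `F`
that is not the sum of two totally positive algebraic integers of `F`. -/
def IsIndecomposableInteger {F : Type*} [Field F] (α : NumberField.RingOfIntegers F) : Prop :=
  IsTotallyPositive (α : F) ∧
    ¬ ∃ β γ : NumberField.RingOfIntegers F,
      IsTotallyPositive (β : F) ∧ IsTotallyPositive (γ : F) ∧ α = β + γ

/-- The indecomposable elements of `𝓞_F⁺` remain indecomposable in `𝓞_K⁺`, for a subfield `F`
of `K`. -/
def IndecomposablesPersist {K : Type*} [Field K] [CharZero K] (F : IntermediateField ℚ K) :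
    Prop :=
  ∀ α : NumberField.RingOfIntegers F, IsIndecomposableInteger α →
    IsIndecomposableInteger
      (algebraMap (NumberField.RingOfIntegers F) (NumberField.RingOfIntegers K) α)

/-- `K = ℚ(√p, √q)` is a real biquadratic field, where `p` and `q` are squarefree positive
integers and `s`, `t` are square roots of `p`, `q` in `K`. -/
structure IsRealBiquadraticPresentation (K : Type*) [Field K] [CharZero K] (p q : ℕ) (s t : K) :
    Prop where
  squarefree_left : Squarefree p
  squarefree_right : Squarefree q
  sq_left : s ^ 2 = (p : K)
  sq_right : t ^ 2 = (q : K)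
  adjoin_eq_top : IntermediateField.adjoin ℚ {s, t} = ⊤
  finrank_eq_four : Module.finrank ℚ K = 4

/-- `K` is a real biquadratic field: a field of degree `4` over `ℚ` of the form `ℚ(√p, √q)` with
squarefree positive integers `p`, `q`. -/
def IsRealBiquadratic (K : Type*) [Field K] [CharZero K] : Prop :=
  ∃ (p q : ℕ) (s t : K), IsRealBiquadraticPresentation K p q s t

/-- The set of quadratic subfields of `K`. -/
def quadraticSubfields (K : Type*) [Field K] [CharZero K] : Set (IntermediateField ℚ K) :=
  {F | Module.finrank ℚ F = 2}

/-- The integer `r = pq / gcd(p, q)²`; the division is exact. -/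
def thirdRadicand (p q : ℕ) : ℕ := p * q / (Nat.gcd p q) ^ 2

/-- Type (1): `p ≡ 2` and `q ≡ 3` modulo `4`. -/
def IsTypeOne (p q : ℕ) : Prop := p % 4 = 2 ∧ q % 4 = 3

/-- Type (2): `p ≡ 2, 3` and `q ≡ 1` modulo `4`. -/
def IsTypeTwo (p q : ℕ) : Prop := (p % 4 = 2 ∨ p % 4 = 3) ∧ q % 4 = 1

/-- Type (3): `p ≡ q ≡ 1` and `gcd(p, q) ≡ 1` modulo `4`. -/
def IsTypeThree (p q : ℕ) : Prop := p % 4 = 1 ∧ q % 4 = 1 ∧ Nat.gcd p q % 4 = 1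

/-- Type (4): `p ≡ q ≡ 1` and `gcd(p, q) ≡ 3` modulo `4`. -/
def IsTypeFour (p q : ℕ) : Prop := p % 4 = 1 ∧ q % 4 = 1 ∧ Nat.gcd p q % 4 = 3

/-!
Let `F = ℚ(√p)`, `K = F(√q)`, `g = gcd(p, q)` and `r = pq / g²`, so that `√r = √p√q / g`. For a
rational `κ` with `κ² < q`, the `F`-linear map `L : K → F` with `√q ↦ κ` fixes `F` and preserves
total positivity, since `σ ∘ L` is, for each real embedding `σ` of `F`, a convex combination of the
two extensions of `σ` to `K`. If moreover `L(𝓞_K) ⊆ 𝓞_F`, then a decomposition `α = β + γ` in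
`𝓞_K⁺` of an element `α` of `𝓞_F⁺` gives the decomposition `α = L(β) + L(γ)` in `𝓞_F⁺`, so
indecomposables of `F` persist in `K`
(`IsRealBiquadraticPresentation.indecomposablesPersist`).

It remains to choose `κ`.
* For `ℚ(√p)` in types (1) and (2), `κ = g` works; for `ℚ(√q)` in these types, `√p ↦ 0` works,
  because all traces from `𝓞_K` to `ℚ(√q)` are divisible by `2`.
* In types (3) and (4), `κ = εg` works for both fields, where `ε = ±1` and `ε ≡ g` modulo `4`.

The condition `g² < q` is equivalent to `p < r`: this is where the order of the radicands enters.
The inclusion `L(𝓞_K) ⊆ 𝓞_F` does not require an integral basis of `𝓞_K`. The relative traces of an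
integral element to the three quadratic subfields and its relative norm to `F` are integral, which
bounds the denominators of its coordinates in the basis `1, √p, √q, √r` by `4` and provides
congruences between them (`exists_quarter_int_coords`). A finite computation modulo `4` concludes.

For the count of quadratic subfields, a quadratic subfield contains an irrational element with
rational square up to a rational translate, and such an element is proportional to `√p`, `√q` or
`√r`. Finally, `p`, `q`, `r` play symmetric roles, and they can always be permuted so that the first
two satisfy the hypotheses of the explicit criterion (`exists_isOrderedTypePair`).
-/

/-! ### Coordinates and homomorphisms of a biquadratic field -/

namespace IsRealBiquadraticPresentation

variable {K : Type*} [Field K] [CharZero K] {p q : ℕ} {s t : K}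

theorem exists_coords (h : IsRealBiquadraticPresentation K p q s t) (x : K) :
    ∃ a b c d : ℚ, x = a + b * s + c * t + d * (s * t) := by
  have hs := h.sq_left
  have ht := h.sq_right
  have hfin : FiniteDimensional ℚ K :=
    FiniteDimensional.of_finrank_pos (by rw [h.finrank_eq_four]; norm_num)
  have hx : x ∈ Algebra.adjoin ℚ ({s, t} : Set K) := by
    rw [← IntermediateField.adjoin_toSubalgebra, h.adjoin_eq_top]
    trivial
  induction hx using Algebra.adjoin_induction with
  | mem y hy =>
    rcases hy with rfl | rfl
    · exact ⟨0, 1, 0, 0, by simp⟩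
    · exact ⟨0, 0, 1, 0, by simp⟩
  | algebraMap r => exact ⟨r, 0, 0, 0, by simp⟩
  | add y z _ _ hy hz =>
    obtain ⟨a, b, c, d, rfl⟩ := hy
    obtain ⟨a', b', c', d', rfl⟩ := hz
    exact ⟨a + a', b + b', c + c', d + d', by push_cast; ring⟩
  | mul y z _ _ hy hz =>
    obtain ⟨a, b, c, d, rfl⟩ := hy
    obtain ⟨a', b', c', d', rfl⟩ := hz
    refine ⟨a * a' + p * b * b' + q * c * c' + p * q * d * d',
      a * b' + b * a' + q * (c * d' + d * c'), a * c' + c * a' + p * (b * d' + d * b'),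
      a * d' + d * a' + b * c' + c * b', ?_⟩
    push_cast
    rw [← hs, ← ht]
    ring

theorem coords_eq_zero (h : IsRealBiquadraticPresentation K p q s t) {a b c d : ℚ}
    (e : (a + b * s + c * t + d * (s * t) : K) = 0) : a = 0 ∧ b = 0 ∧ c = 0 ∧ d = 0 := by
  have hli : LinearIndependent ℚ ![1, s, t, s * t] := by
    refine linearIndependent_of_top_le_span_of_card_eq_finrank (fun x _ ↦ ?_)
      (by rw [h.finrank_eq_four, Fintype.card_fin])
    obtain ⟨a, b, c, d, rfl⟩ := h.exists_coords x
    rw [Submodule.mem_span_range_iff_exists_fun]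
    exact ⟨![a, b, c, d], by simp [Fin.sum_univ_four, Rat.smul_def]⟩
  have := Fintype.linearIndependent_iff.1 hli ![a, b, c, d]
    (by simpa [Fin.sum_univ_four, Rat.smul_def] using e)
  exact ⟨this 0, this 1, this 2, this 3⟩

theorem coords_unique (h : IsRealBiquadraticPresentation K p q s t) {a b c d a' b' c' d' : ℚ}
    (e : (a + b * s + c * t + d * (s * t) : K) = a' + b' * s + c' * t + d' * (s * t)) :
    a = a' ∧ b = b' ∧ c = c' ∧ d = d' := by
  have := h.coords_eq_zero (a := a - a') (b := b - b') (c := c - c') (d := d - d')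
    (by push_cast; linear_combination e)
  simpa only [sub_eq_zero] using this

/-- The field `K` is the universal field of characteristic zero with square roots of `p` and
`q`: this yields both its automorphisms and its real embeddings. -/
theorem exists_ringHom (h : IsRealBiquadraticPresentation K p q s t) {A : Type*} [Field A]
    [CharZero A] {S T : A} (hS : S ^ 2 = (p : A)) (hT : T ^ 2 = (q : A)) :
    ∃ f : K →+* A, f s = S ∧ f t = T := by
  choose a b c d hx using h.exists_coords
  have hs := h.sq_left
  have ht := h.sq_right
  let F : K → A := fun x ↦ a x + b x * S + c x * T + d x * (S * T)
  have hF : ∀ (x : K) (a' b' c' d' : ℚ), x = a' + b' * s + c' * t + d' * (s * t) →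
      F x = a' + b' * S + c' * T + d' * (S * T) := by
    intro x a' b' c' d' e
    obtain ⟨h1, h2, h3, h4⟩ := h.coords_unique ((hx x).symm.trans e)
    simp only [F, h1, h2, h3, h4]
  refine ⟨⟨⟨⟨F, ?_⟩, fun x y ↦ ?_⟩, ?_, fun x y ↦ ?_⟩, ?_, ?_⟩
  · rw [hF 1 1 0 0 0 (by simp)]; simp
  · change F (x * y) = F x * F y
    rw [hF (x * y) (a x * a y + p * b x * b y + q * c x * c y + p * q * d x * d y)
      (a x * b y + b x * a y + q * (c x * d y + d x * c y))
      (a x * c y + c x * a y + p * (b x * d y + d x * b y))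
      (a x * d y + d x * a y + b x * c y + c x * b y)]
    · push_cast
      rw [← hS, ← hT]
      simp only [F]
      ring
    · conv_lhs => rw [hx x, hx y]
      push_cast
      rw [← hs, ← ht]
      ring
  · change F 0 = 0
    rw [hF 0 0 0 0 0 (by simp)]; simp
  · change F (x + y) = F x + F y
    rw [hF (x + y) (a x + a y) (b x + b y) (c x + c y) (d x + d y)]
    · push_cast
      simp only [F]
      ring
    · conv_lhs => rw [hx x, hx y]
      push_cast
      ring
  · change F s = S
    rw [hF s 0 1 0 0 (by simp)]; simp
  · change F t = T
    rw [hF t 0 0 1 0 (by simp)]; simp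

theorem swap (h : IsRealBiquadraticPresentation K p q s t) :
    IsRealBiquadraticPresentation K q p t s :=
  ⟨h.squarefree_right, h.squarefree_left, h.sq_right, h.sq_left,
    by rw [Set.pair_comm]; exact h.adjoin_eq_top, h.finrank_eq_four⟩

end IsRealBiquadraticPresentation

/-! ### Transfer of decompositions to a quadratic subfield -/

theorem exists_coords_of_mem_adjoin_sqrt {K : Type*} [Field K] [CharZero K] {n : ℕ} {w x : K}
    (hw : w ^ 2 = (n : K)) (hx : x ∈ IntermediateField.adjoin ℚ {w}) :
    ∃ a b : ℚ, x = a + b * w := by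
  have hint : IsIntegral ℚ w := ⟨.X ^ 2 - .C (n : ℚ),
    Polynomial.monic_X_pow_sub_C _ two_ne_zero, by simp [hw]⟩
  rw [← IntermediateField.mem_toSubalgebra,
    IntermediateField.adjoin_simple_toSubalgebra_of_isAlgebraic hint.isAlgebraic] at hx
  induction hx using Algebra.adjoin_induction with
  | mem y hy => exact ⟨0, 1, by simpa using hy⟩
  | algebraMap r => exact ⟨r, 0, by simp⟩
  | add y z _ _ hy hz =>
    obtain ⟨a, b, rfl⟩ := hy
    obtain ⟨a', b', rfl⟩ := hz
    exact ⟨a + a', b + b', by push_cast; ring⟩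
  | mul y z _ _ hy hz =>
    obtain ⟨a, b, rfl⟩ := hy
    obtain ⟨a', b', rfl⟩ := hz
    exact ⟨a * a' + n * b * b', a * b' + b * a', by push_cast; rw [← hw]; ring⟩

/-- The decomposition-transfer principle. For `F = ℚ(√p)` and rational `κ` with `κ² < q`, the
`F`-linear map `K → F` with `√q ↦ κ` preserves total positivity: its composite with a real embedding
of `F` is a convex combination of the two extensions of that embedding to `K`. If it also maps
`𝓞_K` into `𝓞_F`, then it turns a decomposition of `α ∈ 𝓞_F⁺` in `𝓞_K⁺` into one in `𝓞_F⁺`. -/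
theorem IsRealBiquadraticPresentation.indecomposablesPersist {K : Type*} [Field K] [CharZero K]
    {p q : ℕ} {s t : K} (h : IsRealBiquadraticPresentation K p q s t) (κ : ℚ) (hκ : κ ^ 2 < q)
    (hint : ∀ a b c d : ℚ, IsIntegral ℤ (a + b * s + c * t + d * (s * t) : K) →
      IsIntegral ℤ ((a + κ * c : ℚ) + (b + κ * d : ℚ) * s : K)) :
    IndecomposablesPersist (IntermediateField.adjoin ℚ {s}) := by
  set F := IntermediateField.adjoin ℚ {s}
  have hsF : s ∈ F := IntermediateField.mem_adjoin_simple_self ℚ s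
  have hmem (x y : ℚ) : (x + y * s : K) ∈ F := by
    have hr (r : ℚ) : (r : K) ∈ F := by simpa only [eq_ratCast] using F.algebraMap_mem r
    exact F.add_mem (hr x) (F.mul_mem (hr y) hsF)
  have key (β : NumberField.RingOfIntegers K) (hβ : IsTotallyPositive (β : K)) (a b c d : ℚ)
      (e : (β : K) = a + b * s + c * t + d * (s * t)) :
      ∃ γ : NumberField.RingOfIntegers F, IsTotallyPositive (γ : F) ∧
        ((γ : F) : K) = (a + κ * c : ℚ) + (b + κ * d : ℚ) * s := by
    have hi : IsIntegral ℤ ((a + κ * c : ℚ) + (b + κ * d : ℚ) * s : K) :=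
      hint a b c d (e ▸ β.isIntegral_coe)
    refine ⟨⟨⟨_, hmem (a + κ * c) (b + κ * d)⟩, ?_⟩, fun σ ↦ ?_, rfl⟩
    · exact (isIntegral_algebraMap_iff (algebraMap F K).injective).1 hi
    · have hS : σ ⟨s, hsF⟩ ^ 2 = (p : ℝ) := by
        rw [← map_pow, ← map_natCast σ]
        congr 1
        exact Subtype.ext (by simpa using h.sq_left)
      set S := σ ⟨s, hsF⟩
      have hσ : σ ⟨_, hmem (a + κ * c) (b + κ * d)⟩ =
          ((a + κ * c : ℚ) : ℝ) + ((b + κ * d : ℚ) : ℝ) * S := by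
        rw [← map_ratCast σ, ← map_ratCast σ, ← map_mul, ← map_add]
        rfl
      change 0 < σ ⟨_, hmem (a + κ * c) (b + κ * d)⟩
      rw [hσ]
      have hq : (√q : ℝ) ^ 2 = q := Real.sq_sqrt q.cast_nonneg
      have hκ' : (κ : ℝ) ^ 2 < q := by exact_mod_cast hκ
      obtain ⟨hκ1, hκ2⟩ := abs_lt_of_sq_lt_sq' (hq.symm ▸ hκ') (Real.sqrt_nonneg _)
      obtain ⟨f, hfs, hft⟩ := h.exists_ringHom hS hq
      obtain ⟨f', hfs', hft'⟩ := h.exists_ringHom hS (T := -√(q : ℝ)) (by rw [neg_sq, hq])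
      have h1 := hβ f
      have h2 := hβ f'
      simp only [e, map_add, map_mul, map_ratCast, hfs, hft, hfs', hft'] at h1 h2
      -- `2√q · σ(L β) = (√q + κ) f(β) + (√q - κ) f'(β)`, for the extensions `f`, `f'` of `σ`.
      have h3 := mul_pos (show 0 < √(q : ℝ) + κ by linarith) h1
      have h4 := mul_pos (show 0 < √(q : ℝ) - κ by linarith) h2
      have hpos : 0 < √(q : ℝ) := by linarith
      refine pos_of_mul_pos_right (a := 2 * √(q : ℝ)) ?_ (by positivity)
      push_cast
      linarith
  rintro α ⟨hα, hdec⟩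
  refine ⟨fun σ ↦ hα (σ.comp (algebraMap F K)), ?_⟩
  rintro ⟨β, γ, hβ, hγ, hsum⟩
  obtain ⟨a, b, c, d, e⟩ := h.exists_coords (β : K)
  obtain ⟨a', b', c', d', e'⟩ := h.exists_coords (γ : K)
  obtain ⟨β', hβ', hb⟩ := key β hβ a b c d e
  obtain ⟨γ', hγ', hc⟩ := key γ hγ a' b' c' d' e'
  refine hdec ⟨β', γ', hβ', hγ', ?_⟩
  obtain ⟨x, y, hxy⟩ := exists_coords_of_mem_adjoin_sqrt h.sq_left (α : F).2
  have hsum' : ((α : F) : K) = β + γ :=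
    congrArg (fun z : NumberField.RingOfIntegers K ↦ (z : K)) hsum
  obtain ⟨h1, h2, h3, h4⟩ := h.coords_unique (a := x) (b := y) (c := 0) (d := 0)
    (a' := a + a') (b' := b + b') (c' := c + c') (d' := d + d') (by
      push_cast
      linear_combination hsum' - hxy + e + e')
  apply NumberField.RingOfIntegers.ext
  apply Subtype.ext
  change ((α : F) : K) = ((β' : F) : K) + ((γ' : F) : K)
  rw [hb, hc, hxy, h1, h2]
  push_cast
  have h3' : (c : K) + c' = 0 := by exact_mod_cast h3.symm
  have h4' : (d : K) + d' = 0 := by exact_mod_cast h4.symm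
  linear_combination -(κ : K) * h3' - κ * s * h4'

/-! ### Integral elements of quadratic fields -/

theorem Rat.exists_int_of_squarefree_mul_sq {n : ℕ} (hn : Squarefree n) {y : ℚ} {m : ℤ}
    (h : n * y ^ 2 = m) : ∃ k : ℤ, y = k := by
  have hden : (y.den : ℚ) ≠ 0 := by exact_mod_cast y.den_nz
  have h1 : (n : ℤ) * y.num ^ 2 = m * (y.den : ℤ) ^ 2 := by
    have : (n : ℚ) * y.num ^ 2 = m * (y.den : ℚ) ^ 2 := by
      rw [← h]
      nth_rewrite 2 [← Rat.num_div_den y]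
      field_simp
    exact_mod_cast this
  have h2 : ((y.den : ℤ) ^ 2) ∣ (n : ℤ) := by
    have hc : IsCoprime ((y.den : ℤ) ^ 2) (y.num ^ 2) :=
      (Rat.isCoprime_num_den y).symm.pow
    exact hc.dvd_of_dvd_mul_right ⟨m, by rw [h1]; ring⟩
  have h3 : y.den * y.den ∣ n := by
    rw [← pow_two]; exact_mod_cast h2
  have h4 : y.den = 1 := Nat.isUnit_iff.1 (hn _ h3)
  exact ⟨y.num, (Rat.coe_int_num_of_den_eq_one h4).symm⟩

theorem exists_int_of_isIntegral_ratCast {K : Type*} [Field K] [CharZero K] {x : ℚ}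
    (h : IsIntegral ℤ (x : K)) : ∃ k : ℤ, x = k := by
  have h' : IsIntegral ℤ (algebraMap ℚ K x) := by simpa using h
  obtain ⟨k, hk⟩ := IsIntegrallyClosed.isIntegral_iff.1
    ((isIntegral_algebraMap_iff (algebraMap ℚ K).injective).1 h')
  exact ⟨k, by simpa using hk.symm⟩

/-- An integral element `x + y√n` has trace and norm in `ℤ`. The ring homomorphism `f` plays the
role of the conjugation `√n ↦ -√n`. -/
theorem exists_half_int_of_isIntegral {K : Type*} [Field K] [CharZero K] {n : ℕ}
    (hn : Squarefree n) {w : K} (hw : w ^ 2 = (n : K)) (f : K →+* K) (hf : f w = -w) {x y : ℚ}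
    (h : IsIntegral ℤ (x + y * w : K)) :
    ∃ X Y : ℤ, x = X / 2 ∧ y = Y / 2 ∧ 4 ∣ X ^ 2 - n * Y ^ 2 := by
  have h' : IsIntegral ℤ (x - y * w : K) := by
    have : (x - y * w : K) = f (x + y * w) := by simp [hf]; ring
    rw [this]
    exact h.map f.toIntAlgHom
  obtain ⟨X, hX⟩ := exists_int_of_isIntegral_ratCast (K := K) (x := 2 * x) (by
    have e : ((2 * x : ℚ) : K) = (x + y * w) + (x - y * w) := by push_cast; ring
    exact e ▸ h.add h')
  obtain ⟨N, hN⟩ := exists_int_of_isIntegral_ratCast (K := K) (x := x ^ 2 - n * y ^ 2) (by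
    have e : ((x ^ 2 - n * y ^ 2 : ℚ) : K) = (x + y * w) * (x - y * w) := by
      push_cast; rw [← hw]; ring
    exact e ▸ h.mul h')
  obtain ⟨Y, hY⟩ := Rat.exists_int_of_squarefree_mul_sq hn (y := 2 * y) (m := X ^ 2 - 4 * N) (by
    push_cast; rw [← hX, ← hN]; ring)
  refine ⟨X, Y, by rw [← hX]; ring, by rw [← hY]; ring, N, ?_⟩
  have : (X : ℚ) ^ 2 - n * Y ^ 2 = 4 * N := by rw [← hX, ← hY, ← hN]; ring
  exact_mod_cast this

theorem isIntegral_half_add_half_mul {K : Type*} [Field K] [CharZero K] {n : ℕ} {w : K}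
    (hw : w ^ 2 = (n : K)) {X Y : ℤ} (h : 4 ∣ X ^ 2 - n * Y ^ 2) :
    IsIntegral ℤ ((X / 2 : ℚ) + (Y / 2 : ℚ) * w : K) := by
  obtain ⟨N, hN⟩ := h
  have hN' : (X : K) ^ 2 - n * Y ^ 2 = 4 * N := by exact_mod_cast congrArg (Int.cast : ℤ → K) hN
  refine ⟨Polynomial.X ^ 2 - Polynomial.C X * Polynomial.X + Polynomial.C N, by monicity!, ?_⟩
  simp only [Polynomial.eval₂_add, Polynomial.eval₂_sub, Polynomial.eval₂_pow,
    Polynomial.eval₂_mul, Polynomial.eval₂_C, Polynomial.eval₂_X]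
  simp only [eq_intCast]
  push_cast
  linear_combination (Y : K) ^ 2 / 4 * hw - hN' / 4

/-! ### Congruences modulo `4` -/

theorem ZMod.natCast_eq_of_mod_four {n k : ℕ} (h : n % 4 = k) : (n : ZMod 4) = k := by
  rw [← ZMod.natCast_mod n 4, h]

theorem Int.two_dvd_of_two_mul_eq_zero_zmod_four {X : ℤ} (h : (2 * X : ZMod 4) = 0) : 2 ∣ X := by
  have := (ZMod.intCast_zmod_eq_zero_iff_dvd (2 * X) 4).1 (by exact_mod_cast h)
  omega

theorem even_of_four_dvd_sq_sub_mul_sq {p : ℕ} (hp : p % 4 = 2 ∨ p % 4 = 3) {X Y : ℤ}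
    (h : 4 ∣ X ^ 2 - p * Y ^ 2) : 2 ∣ X ∧ 2 ∣ Y := by
  have key : ∀ p x y : ZMod 4, p = 2 ∨ p = 3 → x ^ 2 - p * y ^ 2 = 0 → 2 * x = 0 ∧ 2 * y = 0 := by
    decide
  have hp' : (p : ZMod 4) = 2 ∨ (p : ZMod 4) = 3 :=
    hp.imp ZMod.natCast_eq_of_mod_four ZMod.natCast_eq_of_mod_four
  have h' := (ZMod.intCast_zmod_eq_zero_iff_dvd _ 4).2 h
  push_cast at h'
  exact (key p X Y hp' h').imp Int.two_dvd_of_two_mul_eq_zero_zmod_four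
    Int.two_dvd_of_two_mul_eq_zero_zmod_four

theorem four_dvd_sq_sub_mul_sq_of_even {p : ℤ} {X Y : ℤ} (hX : 2 ∣ X) (hY : 2 ∣ Y) :
    4 ∣ X ^ 2 - p * Y ^ 2 := by
  obtain ⟨x, rfl⟩ := hX
  obtain ⟨y, rfl⟩ := hY
  exact ⟨x ^ 2 - p * y ^ 2, by ring⟩

theorem four_dvd_sq_sub_mul_sq_of_one {p : ℕ} (hp : p % 4 = 1) {X Y : ℤ} (h : 2 ∣ X - Y) :
    4 ∣ X ^ 2 - p * Y ^ 2 := by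
  obtain ⟨k, hk⟩ := h
  have hp' : (p : ℤ) = 4 * (p / 4 : ℕ) + 1 := by omega
  obtain rfl : X = Y + 2 * k := by omega
  rw [hp']
  exact ⟨k * Y + k ^ 2 - (p / 4 : ℕ) * Y ^ 2, by ring⟩

/-! ### Coordinates of integral elements of a biquadratic field -/

namespace IsRealBiquadraticPresentation

variable {K : Type*} [Field K] [CharZero K] {p q : ℕ} {s t : K}

theorem pos_left (h : IsRealBiquadraticPresentation K p q s t) : 0 < p :=
  Nat.pos_of_ne_zero h.squarefree_left.ne_zero

/-- The factorization `p = ga`, `q = gb`, `r = ab` behind the symmetry between `p`, `q`, `r`. -/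
theorem exists_factorization (h : IsRealBiquadraticPresentation K p q s t) :
    ∃ g a b : ℕ, 0 < g ∧ Nat.gcd p q = g ∧ p = g * a ∧ q = g * b ∧ thirdRadicand p q = a * b ∧
      Nat.Coprime a b ∧ Nat.Coprime g b := by
  have hg : 0 < Nat.gcd p q := Nat.gcd_pos_of_pos_left _ h.pos_left
  obtain ⟨a, b, hab, ha, hb⟩ := Nat.exists_coprime p q
  have ha' : p = Nat.gcd p q * a := by rw [mul_comm]; exact ha
  have hb' : q = Nat.gcd p q * b := by rw [mul_comm]; exact hb
  have h2 := h.squarefree_right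
  generalize hG : Nat.gcd p q = g at *
  refine ⟨g, a, b, hg, rfl, ha', hb', ?_, hab, ?_⟩
  · rw [thirdRadicand, hG, ha', hb']
    exact Nat.div_eq_of_eq_mul_left (by positivity) (by ring)
  · rw [hb'] at h2; exact Nat.coprime_of_squarefree_mul h2

theorem sq_third (h : IsRealBiquadraticPresentation K p q s t) :
    (s * t / (Nat.gcd p q : K)) ^ 2 = (thirdRadicand p q : K) := by
  obtain ⟨g, a, b, hg, hG, hp, hq, hr, -⟩ := h.exists_factorization
  have hg' : (g : K) ≠ 0 := by exact_mod_cast hg.ne'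
  rw [hr, hG, div_pow, mul_pow, h.sq_left, h.sq_right, hp, hq]
  push_cast
  field_simp

theorem squarefree_third (h : IsRealBiquadraticPresentation K p q s t) :
    Squarefree (thirdRadicand p q) := by
  obtain ⟨g, a, b, hg, hG, hp, hq, hr, hab, -⟩ := h.exists_factorization
  rw [hr, Nat.squarefree_mul hab]
  exact ⟨h.squarefree_left.squarefree_of_dvd ⟨g, by rw [hp, mul_comm]⟩,
    h.squarefree_right.squarefree_of_dvd ⟨g, by rw [hq, mul_comm]⟩⟩

/-- The constraints on the coordinates of an integral element in the basis `1, √p, √q, √r`, coming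
from its relative traces to the three quadratic subfields and its relative norm to `ℚ(√p)`. -/
theorem exists_quarter_int_coords (h : IsRealBiquadraticPresentation K p q s t) {g a b : ℕ}
    (hg : 0 < g) (hG : Nat.gcd p q = g) (hp : p = g * a) (hq : q = g * b)
    (hr : thirdRadicand p q = a * b) {x y z v : ℚ}
    (hi : IsIntegral ℤ (x + y * s + z * t + v * (s * t) : K)) :
    ∃ A B C D X Y : ℤ, x = A / 4 ∧ y = B / 4 ∧ z = C / 4 ∧ v = D / (4 * g) ∧
      4 ∣ A ^ 2 - p * B ^ 2 ∧ 4 ∣ A ^ 2 - q * C ^ 2 ∧ 4 ∣ A ^ 2 - (a * b : ℕ) * D ^ 2 ∧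
      8 * X = A ^ 2 + p * B ^ 2 - q * C ^ 2 - (a * b : ℕ) * D ^ 2 ∧
      4 * Y = A * B - b * (C * D) ∧ 4 ∣ X ^ 2 - p * Y ^ 2 := by
  have hs := h.sq_left
  have ht := h.sq_right
  have hu := h.sq_third
  have hgK : (g : K) ≠ 0 := by exact_mod_cast hg.ne'
  have hgQ : (g : ℚ) ≠ 0 := by exact_mod_cast hg.ne'
  rw [hG, hr] at hu
  have hsqr := hr ▸ h.squarefree_third
  obtain ⟨f₁, f₁s, f₁t⟩ := h.exists_ringHom hs (T := -t) (by rw [neg_sq, ht])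
  obtain ⟨f₂, f₂s, f₂t⟩ := h.exists_ringHom (S := -s) (by rw [neg_sq, hs]) ht
  obtain ⟨f₃, f₃s, f₃t⟩ := h.exists_ringHom (S := -s) (T := -t) (by rw [neg_sq, hs])
    (by rw [neg_sq, ht])
  have i₁ := hi.map f₁.toIntAlgHom
  have i₂ := hi.map f₂.toIntAlgHom
  have i₃ := hi.map f₃.toIntAlgHom
  have e₁ : f₁.toIntAlgHom (x + y * s + z * t + v * (s * t)) =
    x + y * s - z * t - v * (s * t) := by simp [f₁s, f₁t]; ring
  have e₂ : f₂.toIntAlgHom (x + y * s + z * t + v * (s * t)) =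
    x - y * s + z * t - v * (s * t) := by simp [f₂s, f₂t]; ring
  have e₃ : f₃.toIntAlgHom (x + y * s + z * t + v * (s * t)) =
    x - y * s - z * t + v * (s * t) := by simp [f₃s, f₃t]; ring
  rw [e₁] at i₁
  rw [e₂] at i₂
  rw [e₃] at i₃
  have j₁ : IsIntegral ℤ ((2 * x : ℚ) + (2 * y : ℚ) * s : K) := by
    have e : ((2 * x : ℚ) + (2 * y : ℚ) * s : K) = (x + y * s + z * t + v * (s * t)) +
      (x + y * s - z * t - v * (s * t)) := by push_cast; ring
    exact e ▸ hi.add i₁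
  have j₂ : IsIntegral ℤ ((2 * x : ℚ) + (2 * z : ℚ) * t : K) := by
    have e : ((2 * x : ℚ) + (2 * z : ℚ) * t : K) = (x + y * s + z * t + v * (s * t)) +
      (x - y * s + z * t - v * (s * t)) := by push_cast; ring
    exact e ▸ hi.add i₂
  have j₃ : IsIntegral ℤ ((2 * x : ℚ) + (2 * (v * g) : ℚ) * (s * t / g) : K) := by
    have e : ((2 * x : ℚ) + (2 * (v * g) : ℚ) * (s * t / g) : K) =
      (x + y * s + z * t + v * (s * t)) + (x - y * s - z * t + v * (s * t)) := by
      push_cast; field_simp; ring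
    exact e ▸ hi.add i₃
  have jN : IsIntegral ℤ ((x ^ 2 + p * y ^ 2 - q * z ^ 2 - p * q * v ^ 2 : ℚ) +
      (2 * (x * y - q * z * v) : ℚ) * s : K) := by
    have e : ((x ^ 2 + p * y ^ 2 - q * z ^ 2 - p * q * v ^ 2 : ℚ) +
      (2 * (x * y - q * z * v) : ℚ) * s : K) = (x + y * s + z * t + v * (s * t)) *
      (x + y * s - z * t - v * (s * t)) := by
      push_cast
      rw [← hs, ← ht]
      ring
    exact e ▸ hi.mul i₁
  obtain ⟨A, B, hA, hB, hAB⟩ := exists_half_int_of_isIntegral h.squarefree_left hs f₂ f₂s j₁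
  obtain ⟨A', C, hA', hC, hAC⟩ := exists_half_int_of_isIntegral h.squarefree_right ht f₁ f₁t j₂
  obtain ⟨A'', D, hA'', hD, hAD⟩ := exists_half_int_of_isIntegral hsqr hu f₁
    (by simp [f₁s, f₁t]; ring) j₃
  obtain ⟨X, Y, hX, hY, hXY⟩ := exists_half_int_of_isIntegral h.squarefree_left hs f₂ f₂s jN
  obtain rfl : A = A' := by
    have : (A : ℚ) = A' := by linarith
    exact_mod_cast this
  obtain rfl : A = A'' := by
    have : (A : ℚ) = A'' := by linarith
    exact_mod_cast this
  have hx : x = A / 4 := by linarith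
  have hy : y = B / 4 := by linarith
  have hz : z = C / 4 := by linarith
  have hv : v = D / (4 * g) := by field_simp; linarith
  refine ⟨A, B, C, D, X, Y, hx, hy, hz, hv, hAB, hAC, hAD, ?_, ?_, hXY⟩
  · have : (8 * X : ℚ) = A ^ 2 + p * B ^ 2 - q * C ^ 2 - (a * b : ℕ) * D ^ 2 := by
      have e : p * q * v ^ 2 = (a * b : ℕ) * D ^ 2 / 16 := by
        rw [hv, hp, hq]; push_cast; field_simp; norm_num
      rw [e, hx, hy, hz] at hX
      linarith
    exact_mod_cast this
  · have : (4 * Y : ℚ) = A * B - b * (C * D) := by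
      have e : q * z * v = b * (C * D) / 16 := by
        rw [hv, hz, hq]; push_cast; field_simp; ring
      rw [e, hx, hy] at hY
      linarith
    exact_mod_cast this

end IsRealBiquadraticPresentation

/-! ### Congruences between the coordinates in the four types -/

/-- In types (1) and (2) the coordinates of an integral element in the basis `1, √p, √q, √r` are
half-integers, subject to these congruences. -/
theorem half_int_of_typeOne_or_typeTwo {p q g a b : ℕ} (hT : IsTypeOne p q ∨ IsTypeTwo p q)
    (hp : p = g * a) (hq : q = g * b) {A B C D X Y : ℤ} (hAB : 4 ∣ A ^ 2 - p * B ^ 2)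
    (hAC : 4 ∣ A ^ 2 - q * C ^ 2) (hAD : 4 ∣ A ^ 2 - (a * b : ℕ) * D ^ 2)
    (hX : 8 * X = A ^ 2 + p * B ^ 2 - q * C ^ 2 - (a * b : ℕ) * D ^ 2)
    (hY : 4 * Y = A * B - b * (C * D)) (hXY : 4 ∣ X ^ 2 - p * Y ^ 2) :
    ∃ A' B' C' D' : ℤ, A = 2 * A' ∧ B = 2 * B' ∧ C = 2 * C' ∧ D = 2 * D' ∧
      2 ∣ A' + g * C' ∧ 2 ∣ B' + D' ∧ 4 ∣ A' ^ 2 - q * C' ^ 2 := by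
  have hp4 : p % 4 = 2 ∨ p % 4 = 3 := hT.elim (fun h ↦ .inl h.1) (fun h ↦ h.1)
  have hq4 : q % 4 = 1 ∨ q % 4 = 3 := hT.elim (fun h ↦ .inr h.2) (fun h ↦ .inl h.2)
  have hgb : g % 2 = 1 ∧ b % 2 = 1 := by
    rw [← Nat.odd_iff, ← Nat.odd_iff, ← Nat.odd_mul, ← hq, Nat.odd_iff]
    omega
  have hg : (g : ZMod 4) = 1 ∨ (g : ZMod 4) = 3 :=
    (show g % 4 = 1 ∨ g % 4 = 3 by omega).imp ZMod.natCast_eq_of_mod_four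
      ZMod.natCast_eq_of_mod_four
  have hb : (b : ZMod 4) = 1 ∨ (b : ZMod 4) = 3 :=
    (show b % 4 = 1 ∨ b % 4 = 3 by omega).imp ZMod.natCast_eq_of_mod_four
      ZMod.natCast_eq_of_mod_four
  -- Since `g` is odd, `r = ab` is congruent to `g²ab = pq` modulo `4`.
  have hr : ((a * b : ℕ) : ZMod 4) = p * q := by
    have : ((g : ZMod 4)) ^ 2 = 1 := by rcases hg with e | e <;> rw [e] <;> decide
    rw [hp, hq]
    push_cast
    linear_combination -(a * b : ZMod 4) * this
  have hpq : ((p : ZMod 4) = 2 ∧ (q : ZMod 4) = 3) ∨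
      (((p : ZMod 4) = 2 ∨ (p : ZMod 4) = 3) ∧ (q : ZMod 4) = 1) :=
    hT.imp (.imp ZMod.natCast_eq_of_mod_four ZMod.natCast_eq_of_mod_four)
      (.imp (.imp ZMod.natCast_eq_of_mod_four ZMod.natCast_eq_of_mod_four)
        ZMod.natCast_eq_of_mod_four)
  have hr4 : (a * b) % 4 = 2 ∨ (a * b) % 4 = 3 := by
    have h1 : ∀ p q : ZMod 4, (p = 2 ∧ q = 3) ∨ ((p = 2 ∨ p = 3) ∧ q = 1) →
      (p * q = ((2 : ℕ) : ZMod 4) ∨ p * q = ((3 : ℕ) : ZMod 4)) := by decide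
    have h2 := h1 p q hpq
    rw [← hr, ZMod.natCast_eq_natCast_iff, ZMod.natCast_eq_natCast_iff] at h2
    exact h2
  obtain ⟨⟨A, rfl⟩, ⟨B, rfl⟩⟩ := even_of_four_dvd_sq_sub_mul_sq hp4 hAB
  obtain ⟨-, ⟨D, rfl⟩⟩ := even_of_four_dvd_sq_sub_mul_sq hr4 hAD
  obtain ⟨⟨X, rfl⟩, ⟨Y, rfl⟩⟩ := even_of_four_dvd_sq_sub_mul_sq hp4 hXY
  obtain ⟨C, rfl⟩ : 2 ∣ C := by
    have : ∀ q y : ZMod 4, q = 1 ∨ q = 3 → q * y ^ 2 = 0 → 2 * y = 0 := by decide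
    have hC : 4 ∣ q * C ^ 2 := by
      have := dvd_sub (Dvd.intro (A ^ 2) rfl : (4 : ℤ) ∣ 4 * A ^ 2) hAC
      ring_nf at this ⊢
      exact this
    have hC' := (ZMod.intCast_zmod_eq_zero_iff_dvd _ 4).2 hC
    push_cast at hC'
    exact Int.two_dvd_of_two_mul_eq_zero_zmod_four
      (this q C (hq4.imp ZMod.natCast_eq_of_mod_four ZMod.natCast_eq_of_mod_four) hC')
  refine ⟨A, B, C, D, rfl, rfl, rfl, rfl, ?_⟩
  have hX' : (A ^ 2 + p * B ^ 2 - q * C ^ 2 - p * q * D ^ 2 : ZMod 4) = 0 := by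
    have e : A ^ 2 + p * B ^ 2 - q * C ^ 2 - (a * b : ℕ) * D ^ 2 = 4 * X := by linarith
    have := (ZMod.intCast_zmod_eq_zero_iff_dvd _ 4).2 (Dvd.intro _ e.symm)
    rw [← hr]
    push_cast at this ⊢
    exact this
  have hY' : (2 * (A * B - b * (C * D)) : ZMod 4) = 0 := by
    have e : 2 * (A * B - b * (C * D)) = 4 * Y := by linarith
    have := (ZMod.intCast_zmod_eq_zero_iff_dvd _ 4).2 (Dvd.intro _ e.symm)
    push_cast at this
    exact this
  rcases hpq with ⟨hp', hq'⟩ | ⟨hp', hq'⟩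
  · have key : ∀ b A B C D : ZMod 4, b = 1 ∨ b = 3 →
        A ^ 2 + 2 * B ^ 2 - 3 * C ^ 2 - 2 * 3 * D ^ 2 = 0 → 2 * (A * B - b * (C * D)) = 0 →
        2 * A = 0 ∧ 2 * C = 0 ∧ 2 * (B + D) = 0 := by decide
    rw [hp', hq'] at hX'
    obtain ⟨h1, h2, h3⟩ := key b A B C D hb hX' hY'
    replace h1 := Int.two_dvd_of_two_mul_eq_zero_zmod_four h1
    replace h2 := Int.two_dvd_of_two_mul_eq_zero_zmod_four h2
    exact ⟨dvd_add h1 (h2.mul_left _),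
      Int.two_dvd_of_two_mul_eq_zero_zmod_four (by exact_mod_cast h3),
      four_dvd_sq_sub_mul_sq_of_even h1 h2⟩
  · have key : ∀ p b A B C D : ZMod 4, p = 2 ∨ p = 3 → b = 1 ∨ b = 3 →
        A ^ 2 + p * B ^ 2 - 1 * C ^ 2 - p * 1 * D ^ 2 = 0 → 2 * (A * B - b * (C * D)) = 0 →
        2 * (A - C) = 0 ∧ 2 * (B + D) = 0 := by
      rintro p b A B C D (rfl | rfl) (rfl | rfl) <;> revert A B C D <;> decide
    rw [hq'] at hX'
    obtain ⟨h1, h2⟩ := key p b A B C D hp' hb hX' hY'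
    replace h1 : 2 ∣ A - C := Int.two_dvd_of_two_mul_eq_zero_zmod_four (by exact_mod_cast h1)
    have hg2 : (2 : ℤ) ∣ g + 1 := by omega
    refine ⟨?_, Int.two_dvd_of_two_mul_eq_zero_zmod_four (by exact_mod_cast h2),
      four_dvd_sq_sub_mul_sq_of_one (by
        rcases hT with h | h
        · have := ZMod.natCast_eq_of_mod_four h.2
          rw [hq'] at this
          exact absurd this (by decide)
        · exact h.2) h1⟩
    have : A + g * C = (A - C) + (g + 1) * C := by ring
    rw [this]
    exact dvd_add h1 (hg2.mul_right C)

/-- In types (3) and (4), with `ε = ±1` the residue of `gcd(p, q)` modulo `4`, the map `√q ↦ εg`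
sends an integral element with quarter-integer coordinates `A, B, C, D` to `(U + V√p) / 2`, where
`U ≡ V` modulo `2`. -/
theorem exists_half_int_of_typeThree_or_typeFour {p q g a b : ℕ} {ε : ℤ}
    (hε : (ε = 1 ∧ g % 4 = 1) ∨ (ε = -1 ∧ g % 4 = 3)) (hp4 : p % 4 = 1) (hq4 : q % 4 = 1)
    (hp : p = g * a) (hq : q = g * b) {A B C D X Y : ℤ} (hAB : 4 ∣ A ^ 2 - p * B ^ 2)
    (hAC : 4 ∣ A ^ 2 - q * C ^ 2) (hAD : 4 ∣ A ^ 2 - (a * b : ℕ) * D ^ 2)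
    (hX : 8 * X = A ^ 2 + p * B ^ 2 - q * C ^ 2 - (a * b : ℕ) * D ^ 2)
    (hY : 4 * Y = A * B - b * (C * D)) :
    ∃ U V : ℤ, A + ε * g * C = 2 * U ∧ B + ε * D = 2 * V ∧ 2 ∣ U - V := by
  have hp' : (p : ZMod 4) = 1 := ZMod.natCast_eq_of_mod_four hp4
  have hq' : (q : ZMod 4) = 1 := ZMod.natCast_eq_of_mod_four hq4
  have hg : (g : ZMod 4) = ε ∧ (ε : ZMod 4) ^ 2 = 1 := by
    rcases hε with ⟨rfl, e⟩ | ⟨rfl, e⟩ <;> rw [ZMod.natCast_eq_of_mod_four e] <;> decide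
  have ha : (a : ZMod 4) = ε := by
    rw [hp] at hp'
    push_cast at hp'
    linear_combination (ε : ZMod 4) * hp' - ε * a * hg.1 - a * hg.2
  have hb : (b : ZMod 4) = ε := by
    rw [hq] at hq'
    push_cast at hq'
    linear_combination (ε : ZMod 4) * hq' - ε * b * hg.1 - b * hg.2
  have hr' : ((a * b : ℕ) : ZMod 4) = 1 := by
    push_cast
    rw [ha, hb, ← pow_two, hg.2]
  have par : ∀ {A B : ℤ} {n : ℕ}, (n : ZMod 4) = 1 → 4 ∣ A ^ 2 - n * B ^ 2 → 2 ∣ A - B := by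
    intro A B n hn h
    have key : ∀ x y : ZMod 4, x ^ 2 - 1 * y ^ 2 = 0 → 2 * (x - y) = 0 := by decide
    have h' := (ZMod.intCast_zmod_eq_zero_iff_dvd _ 4).2 h
    push_cast at h'
    rw [hn] at h'
    exact Int.two_dvd_of_two_mul_eq_zero_zmod_four (by exact_mod_cast key A B h')
  have pB := par hp' hAB
  have pC := par hq' hAC
  have pD := par hr' hAD
  have hε2 : (2 : ℤ) ∣ ε * g - 1 ∧ (2 : ℤ) ∣ ε - 1 := by
    rcases hε with ⟨rfl, e⟩ | ⟨rfl, e⟩ <;> omega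
  obtain ⟨U, hU⟩ : 2 ∣ A + ε * g * C := by
    have : A + ε * g * C = (A - C) + (ε * g - 1) * C + 2 * C := by ring
    rw [this]
    exact dvd_add (dvd_add pC (hε2.1.mul_right C)) (Dvd.intro _ rfl)
  obtain ⟨V, hV⟩ : 2 ∣ B + ε * D := by
    have : B + ε * D = (B - D) + (ε - 1) * D + 2 * D := by ring
    rw [this]
    exact dvd_add (dvd_add (by omega) (hε2.2.mul_right D)) (Dvd.intro _ rfl)
  refine ⟨U, V, hU, hV, ?_⟩
  suffices h : ((A + ε * g * C - (B + ε * D) : ℤ) : ZMod 4) = 0 by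
    have := (ZMod.intCast_zmod_eq_zero_iff_dvd _ 4).1 h
    omega
  push_cast
  rw [hg.1, ← pow_two, hg.2]
  rcases Int.even_or_odd' A with ⟨A, rfl | rfl⟩
  · -- All coordinates are even, and the integrality of `X` decides.
    obtain ⟨B, rfl⟩ : 2 ∣ B := by omega
    obtain ⟨C, rfl⟩ : 2 ∣ C := by omega
    obtain ⟨D, rfl⟩ : 2 ∣ D := by omega
    have e : 2 * (A ^ 2 + p * B ^ 2 - q * C ^ 2 - (a * b : ℕ) * D ^ 2) = 4 * X := by linarith
    have h := (ZMod.intCast_zmod_eq_zero_iff_dvd _ 4).2 (Dvd.intro _ e.symm)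
    rw [Int.cast_mul, Int.cast_sub, Int.cast_sub, Int.cast_add, Int.cast_mul, Int.cast_mul,
      Int.cast_mul, Int.cast_natCast, Int.cast_natCast, Int.cast_natCast, hp', hq', hr'] at h
    push_cast at h ⊢
    have key : ∀ ε A B C D : ZMod 4, ε ^ 2 = 1 →
        2 * (A ^ 2 + 1 * B ^ 2 - 1 * C ^ 2 - 1 * D ^ 2) = 0 →
        2 * A + 1 * (2 * C) - (2 * B + ε * (2 * D)) = 0 := by decide
    exact key ε A B C D hg.2 h
  · -- All coordinates are odd, and the integrality of `Y` decides.
    obtain ⟨B, rfl⟩ : ∃ k, B = 2 * k + 1 := ⟨B / 2, by omega⟩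
    obtain ⟨C, rfl⟩ : ∃ k, C = 2 * k + 1 := ⟨C / 2, by omega⟩
    obtain ⟨D, rfl⟩ : ∃ k, D = 2 * k + 1 := ⟨D / 2, by omega⟩
    have h := (ZMod.intCast_zmod_eq_zero_iff_dvd _ 4).2 (Dvd.intro _ hY)
    push_cast at h ⊢
    rw [hb] at h
    have key : ∀ ε A B C D : ZMod 4, ε ^ 2 = 1 →
        (2 * A + 1) * (2 * B + 1) - ε * ((2 * C + 1) * (2 * D + 1)) = 0 →
        2 * A + 1 + 1 * (2 * C + 1) - (2 * B + 1 + ε * (2 * D + 1)) = 0 := by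
      have hε : ∀ ε : ZMod 4, ε ^ 2 = 1 → ε = 1 ∨ ε = 3 := by decide
      intro ε A B C D h
      obtain rfl | rfl := hε ε h <;> revert A B C D <;> decide
    exact key ε A B C D hg.2 h

/-! ### Persistence in the four types -/

namespace IsRealBiquadraticPresentation

variable {K : Type*} [Field K] [CharZero K] {p q : ℕ} {s t : K}

theorem sq_gcd_lt_right (h : IsRealBiquadraticPresentation K p q s t)
    (hlt : p < thirdRadicand p q) : Nat.gcd p q ^ 2 < q := by
  obtain ⟨g, a, b, hg, hG, hp, hq, hr, -⟩ := h.exists_factorization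
  rw [hr, hp, mul_comm g a] at hlt
  rw [hG, hq, pow_two]
  exact Nat.mul_lt_mul_of_pos_left (Nat.lt_of_mul_lt_mul_left hlt) hg

theorem persist_left_of_typeOne_or_typeTwo (h : IsRealBiquadraticPresentation K p q s t)
    (hT : IsTypeOne p q ∨ IsTypeTwo p q) (hlt : p < thirdRadicand p q) :
    IndecomposablesPersist (IntermediateField.adjoin ℚ {s}) := by
  obtain ⟨g, a, b, hg, hG, hp, hq, hr, -⟩ := h.exists_factorization
  have hgQ : (g : ℚ) ≠ 0 := by exact_mod_cast hg.ne'
  refine h.indecomposablesPersist g (by exact_mod_cast hG ▸ h.sq_gcd_lt_right hlt) ?_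
  intro x y z v hi
  obtain ⟨A, B, C, D, X, Y, rfl, rfl, rfl, rfl, hAB, hAC, hAD, hX, hY, hXY⟩ :=
    h.exists_quarter_int_coords hg hG hp hq hr hi
  obtain ⟨A, B, C, D, rfl, rfl, rfl, rfl, h1, h2, -⟩ :=
    half_int_of_typeOne_or_typeTwo hT hp hq hAB hAC hAD hX hY hXY
  have e := isIntegral_half_add_half_mul h.sq_left
    (four_dvd_sq_sub_mul_sq_of_even (p := p) h1 h2)
  have e1 : ((2 * A : ℤ) / 4 + g * ((2 * C : ℤ) / 4) : ℚ) = (A + g * C : ℤ) / 2 := by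
    push_cast; ring
  have e2 : ((2 * B : ℤ) / 4 + g * ((2 * D : ℤ) / (4 * g)) : ℚ) = (B + D : ℤ) / 2 := by
    push_cast; field_simp; ring
  rw [e1, e2]
  exact_mod_cast e

theorem persist_right_of_typeOne_or_typeTwo (h : IsRealBiquadraticPresentation K p q s t)
    (hT : IsTypeOne p q ∨ IsTypeTwo p q) :
    IndecomposablesPersist (IntermediateField.adjoin ℚ {t}) := by
  obtain ⟨g, a, b, hg, hG, hp, hq, hr, -⟩ := h.exists_factorization
  refine h.swap.indecomposablesPersist 0 (by simpa using h.pos_left) ?_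
  intro x z y v hi
  have hi' : IsIntegral ℤ (x + y * s + z * t + v * (s * t) : K) := by
    have e : (x + y * s + z * t + v * (s * t) : K) = x + z * t + y * s + v * (t * s) := by ring
    exact e ▸ hi
  obtain ⟨A, B, C, D, X, Y, rfl, rfl, rfl, rfl, hAB, hAC, hAD, hX, hY, hXY⟩ :=
    h.exists_quarter_int_coords hg hG hp hq hr hi'
  obtain ⟨A, B, C, D, rfl, rfl, rfl, rfl, -, -, h3⟩ :=
    half_int_of_typeOne_or_typeTwo hT hp hq hAB hAC hAD hX hY hXY
  have e := isIntegral_half_add_half_mul h.sq_right h3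
  convert e using 3
  · push_cast; ring
  · push_cast; ring

theorem persist_left_of_typeThree_or_typeFour (h : IsRealBiquadraticPresentation K p q s t)
    (hT : IsTypeThree p q ∨ IsTypeFour p q) (hlt : p < thirdRadicand p q) :
    IndecomposablesPersist (IntermediateField.adjoin ℚ {s}) := by
  obtain ⟨g, a, b, hg, hG, hp, hq, hr, -⟩ := h.exists_factorization
  have hgQ : (g : ℚ) ≠ 0 := by exact_mod_cast hg.ne'
  have hp4 : p % 4 = 1 := hT.elim (·.1) (·.1)
  have hq4 : q % 4 = 1 := hT.elim (·.2.1) (·.2.1)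
  obtain ⟨ε, hε⟩ : ∃ ε : ℤ, (ε = 1 ∧ g % 4 = 1) ∨ (ε = -1 ∧ g % 4 = 3) :=
    hT.elim (fun h ↦ ⟨1, .inl ⟨rfl, hG ▸ h.2.2⟩⟩) (fun h ↦ ⟨-1, .inr ⟨rfl, hG ▸ h.2.2⟩⟩)
  have hε2 : (ε : ℚ) ^ 2 = 1 := by rcases hε with ⟨rfl, -⟩ | ⟨rfl, -⟩ <;> norm_num
  refine h.indecomposablesPersist (ε * g) ?_ ?_
  · rw [mul_pow, hε2, one_mul]
    exact_mod_cast hG ▸ h.sq_gcd_lt_right hlt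
  intro x y z v hi
  obtain ⟨A, B, C, D, X, Y, rfl, rfl, rfl, rfl, hAB, hAC, hAD, hX, hY, hXY⟩ :=
    h.exists_quarter_int_coords hg hG hp hq hr hi
  obtain ⟨U, V, hU, hV, hUV⟩ :=
    exists_half_int_of_typeThree_or_typeFour hε hp4 hq4 hp hq hAB hAC hAD hX hY
  have e := isIntegral_half_add_half_mul h.sq_left (four_dvd_sq_sub_mul_sq_of_one hp4 hUV)
  have hU' : (A + ε * g * C : ℚ) = 2 * U := by exact_mod_cast hU
  have hV' : (B + ε * D : ℚ) = 2 * V := by exact_mod_cast hV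
  have e1 : (A / 4 + ε * g * (C / 4) : ℚ) = U / 2 := by linear_combination hU' / 4
  have e2 : (B / 4 + ε * g * (D / (4 * g)) : ℚ) = V / 2 := by
    field_simp
    linarith
  rw [e1, e2]
  exact_mod_cast e

theorem thirdRadicand_comm (p q : ℕ) : thirdRadicand p q = thirdRadicand q p := by
  rw [thirdRadicand, thirdRadicand, mul_comm, Nat.gcd_comm]

theorem persist_of_typeThree_or_typeFour (h : IsRealBiquadraticPresentation K p q s t)
    (hT : IsTypeThree p q ∨ IsTypeFour p q) (hp : p < thirdRadicand p q)
    (hq : q < thirdRadicand p q) :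
    IndecomposablesPersist (IntermediateField.adjoin ℚ {s}) ∧
      IndecomposablesPersist (IntermediateField.adjoin ℚ {t}) := by
  refine ⟨h.persist_left_of_typeThree_or_typeFour hT hp,
    h.swap.persist_left_of_typeThree_or_typeFour ?_ (thirdRadicand_comm p q ▸ hq)⟩
  simpa only [IsTypeThree, IsTypeFour, Nat.gcd_comm q p, and_left_comm] using hT

/-- The presentation `K = ℚ(√p, √r)`, with `√r = √p√q / gcd(p, q)`. -/
theorem third (h : IsRealBiquadraticPresentation K p q s t) :
    IsRealBiquadraticPresentation K p (thirdRadicand p q) s (s * t / (Nat.gcd p q : K)) := by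
  refine ⟨h.squarefree_left, h.squarefree_third, h.sq_left, h.sq_third, ?_, h.finrank_eq_four⟩
  rw [eq_top_iff, ← h.adjoin_eq_top, IntermediateField.adjoin_le_iff]
  have hs0 : s ≠ 0 := by
    rintro rfl
    have := h.sq_left
    rw [zero_pow two_ne_zero] at this
    exact h.pos_left.ne (by exact_mod_cast this)
  have hg : (Nat.gcd p q : K) ≠ 0 := by
    exact_mod_cast (Nat.gcd_pos_of_pos_left q h.pos_left).ne'
  set L := IntermediateField.adjoin ℚ {s, s * t / (Nat.gcd p q : K)}
  have h1 : s ∈ L := IntermediateField.subset_adjoin _ _ (by simp)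
  have h2 : s * t / (Nat.gcd p q : K) ∈ L := IntermediateField.subset_adjoin _ _ (by simp)
  rintro x (rfl | rfl)
  · exact h1
  · have e : x = s * x / (Nat.gcd p q : K) * (Nat.gcd p q : K) / s := by field_simp
    rw [e]
    exact L.div_mem (L.mul_mem h2 (natCast_mem L _)) h1

theorem thirdRadicand_third (h : IsRealBiquadraticPresentation K p q s t) :
    thirdRadicand p (thirdRadicand p q) = q := by
  obtain ⟨g, a, b, hg, hG, hp, hq, hr, hab, hgb⟩ := h.exists_factorization
  have ha : 0 < a := by
    have := h.pos_left
    rw [hp] at this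
    exact Nat.pos_of_mul_pos_left this
  have : Nat.gcd p (a * b) = a := by
    rw [hp, mul_comm g a, Nat.gcd_mul_left, hgb, mul_one]
  rw [hr, thirdRadicand, this, hp, hq]
  exact Nat.div_eq_of_eq_mul_left (by positivity) (by ring)

/-! ### The quadratic subfields -/

theorem left_ne_right (h : IsRealBiquadraticPresentation K p q s t) : p ≠ q := by
  rintro rfl
  have e : (s - t) * (s + t) = 0 := by linear_combination h.sq_left - h.sq_right
  rcases mul_eq_zero.1 e with e | e
  · have := h.coords_eq_zero (a := 0) (b := 1) (c := -1) (d := 0) (by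
      push_cast; linear_combination e)
    exact one_ne_zero this.2.1
  · have := h.coords_eq_zero (a := 0) (b := 1) (c := 1) (d := 0) (by
      push_cast; linear_combination e)
    exact one_ne_zero this.2.1

theorem finrank_adjoin_left (h : IsRealBiquadraticPresentation K p q s t) :
    Module.finrank ℚ (IntermediateField.adjoin ℚ {s}) = 2 := by
  have hmonic : (Polynomial.X ^ 2 - Polynomial.C (p : ℚ)).Monic :=
    Polynomial.monic_X_pow_sub_C _ two_ne_zero
  have hroot : Polynomial.aeval s (Polynomial.X ^ 2 - Polynomial.C (p : ℚ)) = 0 := by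
    simp [h.sq_left]
  have hint : IsIntegral ℚ s := ⟨_, hmonic, hroot⟩
  rw [IntermediateField.adjoin.finrank hint]
  refine le_antisymm ?_ ((minpoly.two_le_natDegree_iff hint).2 ?_)
  · exact (Polynomial.natDegree_le_natDegree (minpoly.min ℚ s hmonic hroot)).trans_eq
      (Polynomial.natDegree_X_pow_sub_C)
  · rintro ⟨x, hx⟩
    have := h.coords_eq_zero (a := x) (b := -1) (c := 0) (d := 0) (by
      push_cast; rw [← hx]; simp)
    exact one_ne_zero (neg_eq_zero.1 this.2.1)

theorem adjoin_left_ne_adjoin_right (h : IsRealBiquadraticPresentation K p q s t) :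
    IntermediateField.adjoin ℚ {s} ≠ IntermediateField.adjoin ℚ {t} := by
  intro e
  have ht : t ∈ IntermediateField.adjoin ℚ {s} :=
    e ▸ IntermediateField.mem_adjoin_simple_self ℚ t
  have hle : IntermediateField.adjoin ℚ {s, t} ≤ IntermediateField.adjoin ℚ {s} := by
    rw [IntermediateField.adjoin_le_iff]
    rintro x (rfl | rfl)
    exacts [IntermediateField.mem_adjoin_simple_self ℚ x, ht]
  rw [h.adjoin_eq_top, top_le_iff] at hle
  have h2 := h.finrank_adjoin_left
  rw [hle, IntermediateField.finrank_top', h.finrank_eq_four] at h2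
  norm_num at h2

theorem eq_adjoin_of_mem (h : IsRealBiquadraticPresentation K p q s t)
    {F : IntermediateField ℚ K} (hF : Module.finrank ℚ F = 2) {c : ℚ} (hc : c ≠ 0)
    (hs : c * s ∈ F) : F = IntermediateField.adjoin ℚ {s} := by
  have hfin : FiniteDimensional ℚ K :=
    FiniteDimensional.of_finrank_pos (by rw [h.finrank_eq_four]; norm_num)
  refine (IntermediateField.eq_of_le_of_finrank_eq ?_ (h.finrank_adjoin_left.trans hF.symm)).symm
  rw [IntermediateField.adjoin_simple_le_iff]
  have hc' : (c : K) ≠ 0 := by exact_mod_cast hc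
  have e : s = c * s / c := by field_simp
  rw [e]
  exact F.div_mem hs (SubfieldClass.ratCast_mem F c)

/-- A quadratic subfield is generated by a pure quadratic irrationality `θ`; comparing coordinates
in `θ² ∈ ℚ` shows that `θ` is a rational multiple of `√p`, `√q` or `√p√q`. -/
theorem quadraticSubfields_eq (h : IsRealBiquadraticPresentation K p q s t) :
    quadraticSubfields K = {IntermediateField.adjoin ℚ {s}, IntermediateField.adjoin ℚ {t},
      IntermediateField.adjoin ℚ {s * t / (Nat.gcd p q : K)}} := by
  have hg : (Nat.gcd p q : K) ≠ 0 := by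
    exact_mod_cast (Nat.gcd_pos_of_pos_left q h.pos_left).ne'
  have hfin : FiniteDimensional ℚ K :=
    FiniteDimensional.of_finrank_pos (by rw [h.finrank_eq_four]; norm_num)
  ext F
  simp only [quadraticSubfields, Set.mem_ofPred_eq, Set.mem_insert_iff, Set.mem_singleton_iff]
  constructor
  swap
  · rintro (rfl | rfl | rfl)
    exacts [h.finrank_adjoin_left, h.swap.finrank_adjoin_left, h.third.swap.finrank_adjoin_left]
  intro hF
  obtain ⟨x, hxF, hx⟩ : ∃ x ∈ F, x ∉ (⊥ : IntermediateField ℚ K) := by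
    by_contra! hcon
    have : F = ⊥ := le_bot_iff.1 hcon
    rw [this, IntermediateField.finrank_bot] at hF
    norm_num at hF
  obtain ⟨m, n, hmn⟩ : ∃ m n : ℚ, x ^ 2 = m * x + n := by
    set y : F := ⟨x, hxF⟩
    have hint : IsIntegral ℚ y := Algebra.IsIntegral.isIntegral y
    have hdeg : (minpoly ℚ y).natDegree ≤ 2 := hF ▸ minpoly.natDegree_le y
    have hdeg' : 2 ≤ (minpoly ℚ y).natDegree := by
      rw [minpoly.two_le_natDegree_iff hint]
      rintro ⟨r, hr⟩
      exact hx (IntermediateField.mem_bot.2 ⟨r, congrArg Subtype.val hr⟩)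
    have h0 := minpoly.aeval ℚ y
    have hmon := (minpoly.monic hint).coeff_natDegree
    have hd : (minpoly ℚ y).natDegree = 2 := le_antisymm hdeg hdeg'
    rw [hd] at hmon
    rw [Polynomial.aeval_eq_sum_range, hd] at h0
    simp only [Finset.sum_range_succ, Finset.sum_range_zero, hmon] at h0
    refine ⟨-(minpoly ℚ y).coeff 1, -(minpoly ℚ y).coeff 0, ?_⟩
    have h0' := congrArg (Subtype.val : F → K) h0
    simp [Rat.smul_def, y] at h0'
    push_cast
    linear_combination h0'
  obtain ⟨a, b, c, d, rfl⟩ := h.exists_coords x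
  have hs := h.sq_left
  have ht := h.sq_right
  obtain ⟨-, e1, e2, e3⟩ := h.coords_unique (a := a ^ 2 + p * b ^ 2 + q * c ^ 2 + p * q * d ^ 2)
    (b := 2 * a * b + 2 * q * c * d) (c := 2 * a * c + 2 * p * b * d) (d := 2 * a * d + 2 * b * c)
    (a' := m * a + n) (b' := m * b) (c' := m * c) (d' := m * d) (by
      push_cast
      rw [← hs, ← ht]
      linear_combination hmn)
  have hmem : b * s + c * t + d * (s * t) ∈ F := by
    have := F.sub_mem hxF (SubfieldClass.ratCast_mem F a)
    ring_nf at this ⊢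
    exact this
  -- Since `q`, `p` and `q / p` are not squares in `ℚ`, at most one of `b`, `c`, `d` is nonzero.
  have k1 : c = 0 ∨ (b = 0 ∧ d = 0) := by
    have e : c * (q * d ^ 2 - b ^ 2) = 0 := by linear_combination d / 2 * e1 - b / 2 * e3
    refine (mul_eq_zero.1 e).imp_right fun e ↦ ?_
    have eK : (q * d ^ 2 - b ^ 2 : K) = 0 := by exact_mod_cast e
    have e' : (d * t - b) * (d * t + b) = 0 := by linear_combination d ^ 2 * ht + eK
    rcases mul_eq_zero.1 e' with e | e
    · have := h.coords_eq_zero (a := -b) (b := 0) (c := d) (d := 0) (by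
        push_cast; linear_combination e)
      exact ⟨neg_eq_zero.1 this.1, this.2.2.1⟩
    · have := h.coords_eq_zero (a := b) (b := 0) (c := d) (d := 0) (by
        push_cast; linear_combination e)
      exact ⟨this.1, this.2.2.1⟩
  have k2 : b = 0 ∨ (c = 0 ∧ d = 0) := by
    have e : b * (p * d ^ 2 - c ^ 2) = 0 := by linear_combination d / 2 * e2 - c / 2 * e3
    refine (mul_eq_zero.1 e).imp_right fun e ↦ ?_
    have eK : (p * d ^ 2 - c ^ 2 : K) = 0 := by exact_mod_cast e
    have e' : (d * s - c) * (d * s + c) = 0 := by linear_combination d ^ 2 * hs + eK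
    rcases mul_eq_zero.1 e' with e | e
    · have := h.coords_eq_zero (a := -c) (b := d) (c := 0) (d := 0) (by
        push_cast; linear_combination e)
      exact ⟨neg_eq_zero.1 this.1, this.2.1⟩
    · have := h.coords_eq_zero (a := c) (b := d) (c := 0) (d := 0) (by
        push_cast; linear_combination e)
      exact ⟨this.1, this.2.1⟩
  have k3 : d = 0 ∨ (b = 0 ∧ c = 0) := by
    have e : d * (q * c ^ 2 - p * b ^ 2) = 0 := by linear_combination c / 2 * e1 - b / 2 * e2
    refine (mul_eq_zero.1 e).imp_right fun e ↦ ?_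
    have eK : (q * c ^ 2 - p * b ^ 2 : K) = 0 := by exact_mod_cast e
    have e' : (c * t - b * s) * (c * t + b * s) = 0 := by
      linear_combination c ^ 2 * ht - b ^ 2 * hs + eK
    rcases mul_eq_zero.1 e' with e | e
    · have := h.coords_eq_zero (a := 0) (b := -b) (c := c) (d := 0) (by
        push_cast; linear_combination e)
      exact ⟨neg_eq_zero.1 this.2.1, this.2.2.1⟩
    · have := h.coords_eq_zero (a := 0) (b := b) (c := c) (d := 0) (by
        push_cast; linear_combination e)
      exact ⟨this.2.1, this.2.2.1⟩
  have hne : ¬ (b = 0 ∧ c = 0 ∧ d = 0) := by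
    rintro ⟨rfl, rfl, rfl⟩
    exact hx (IntermediateField.mem_bot.2 ⟨a, by simp⟩)
  by_cases hb : b = 0
  · by_cases hc : c = 0
    · have hd : d ≠ 0 := fun hd ↦ hne ⟨hb, hc, hd⟩
      have hgQ : (Nat.gcd p q : ℚ) ≠ 0 := by
        exact_mod_cast (Nat.gcd_pos_of_pos_left q h.pos_left).ne'
      refine .inr (.inr (h.third.swap.eq_adjoin_of_mem hF (mul_ne_zero hd hgQ) ?_))
      have e : ((d * Nat.gcd p q : ℚ) : K) * (s * t / (Nat.gcd p q : K)) =
          b * s + c * t + d * (s * t) := by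
        rw [hb, hc]; push_cast; field_simp; ring
      exact e ▸ hmem
    · obtain ⟨-, hd⟩ := k1.resolve_left hc
      refine .inr (.inl (h.swap.eq_adjoin_of_mem hF hc ?_))
      have e : (c * t : K) = b * s + c * t + d * (s * t) := by rw [hb, hd]; simp
      exact e ▸ hmem
  · obtain ⟨hc, hd⟩ := k2.resolve_left hb
    refine .inl (h.eq_adjoin_of_mem hF hb ?_)
    have e : (b * s : K) = b * s + c * t + d * (s * t) := by rw [hc, hd]; simp
    exact e ▸ hmem

theorem ncard_quadraticSubfields (h : IsRealBiquadraticPresentation K p q s t) :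
    (quadraticSubfields K).ncard = 3 := by
  rw [h.quadraticSubfields_eq]
  have h3 : IntermediateField.adjoin ℚ {t} ≠
      IntermediateField.adjoin ℚ {s * t / (Nat.gcd p q : K)} := by
    have := h.swap.third.adjoin_left_ne_adjoin_right
    rwa [mul_comm, Nat.gcd_comm] at this
  exact Set.ncard_eq_three.2 ⟨_, _, _, h.adjoin_left_ne_adjoin_right,
    h.third.adjoin_left_ne_adjoin_right, h3, rfl⟩

end IsRealBiquadraticPresentation

/-! ### Permuting the three radicands -/

/-- The hypotheses under which the indecomposables of both `ℚ(√p)` and `ℚ(√q)` persist. -/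
def IsOrderedTypePair (p q : ℕ) : Prop :=
  ((IsTypeOne p q ∨ IsTypeTwo p q) ∧ p < thirdRadicand p q) ∨
    ((IsTypeThree p q ∨ IsTypeFour p q) ∧ p < q ∧ q < thirdRadicand p q)

namespace IsRealBiquadraticPresentation

variable {K : Type*} [Field K] [CharZero K] {p q : ℕ} {s t : K}

theorem persist_of_isOrderedTypePair (h : IsRealBiquadraticPresentation K p q s t)
    (hT : IsOrderedTypePair p q) :
    IndecomposablesPersist (IntermediateField.adjoin ℚ {s}) ∧
      IndecomposablesPersist (IntermediateField.adjoin ℚ {t}) := by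
  rcases hT with ⟨hT, hlt⟩ | ⟨hT, h1, h2⟩
  · exact ⟨h.persist_left_of_typeOne_or_typeTwo hT hlt, h.persist_right_of_typeOne_or_typeTwo hT⟩
  · exact h.persist_of_typeThree_or_typeFour hT (h1.trans h2) h2

/-- A triple `(p, q, r)` in which each entry is the third radicand of the other two. -/
theorem exists_triple (h : IsRealBiquadraticPresentation K p q s t) :
    ∃ (r : ℕ) (u : K), IsRealBiquadraticPresentation K p r s u ∧
      IsRealBiquadraticPresentation K q r t u ∧ thirdRadicand p q = r ∧
      thirdRadicand p r = q ∧ thirdRadicand q r = p := by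
  refine ⟨thirdRadicand p q, s * t / (Nat.gcd p q : K), h.third, ?_, rfl, h.thirdRadicand_third, ?_⟩
  · have := h.swap.third
    rwa [thirdRadicand_comm, mul_comm, Nat.gcd_comm] at this
  · rw [thirdRadicand_comm p q]; exact h.swap.thirdRadicand_third

/-- For `q` odd, `gcd(p, q)` is odd, and `pq = gcd(p, q)² r` gives `r ≡ pq` modulo `4`. -/
theorem third_mod_four (h : IsRealBiquadraticPresentation K p q s t) (hodd : q % 2 = 1) :
    thirdRadicand p q % 4 = (p % 4) * (q % 4) % 4 := by
  obtain ⟨g, a, b, hg, hG, hp, hq, hr, -⟩ := h.exists_factorization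
  have hgo : Odd g := Nat.Odd.of_mul_left (hq ▸ Nat.odd_iff.2 hodd)
  have hg4 : g ^ 2 % 4 = 1 := by
    have := Nat.odd_iff.1 hgo
    rcases (by omega : g % 4 = 1 ∨ g % 4 = 3) with h | h <;> rw [Nat.pow_mod, h]
  have e : p * q = g ^ 2 * (a * b) := by rw [hp, hq]; ring
  rw [← Nat.mul_mod, e, Nat.mul_mod, hg4, one_mul, Nat.mod_mod, hr]

theorem isOrderedTypePair_of_one (hp : p % 4 = 1) (hq : q % 4 = 1) (h1 : p < q)
    (h2 : q < thirdRadicand p q) : IsOrderedTypePair p q := by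
  have hodd : Odd (Nat.gcd p q) :=
    (Nat.odd_iff.2 (by omega : p % 2 = 1)).of_dvd_nat (Nat.gcd_dvd_left p q)
  have : Nat.gcd p q % 4 = 1 ∨ Nat.gcd p q % 4 = 3 := by
    have := Nat.odd_iff.1 hodd
    omega
  exact .inr ⟨this.imp (⟨hp, hq, ·⟩) (⟨hp, hq, ·⟩), h1, h2⟩

theorem left_mod_four (h : IsRealBiquadraticPresentation K p q s t) :
    p % 4 = 1 ∨ p % 4 = 2 ∨ p % 4 = 3 := by
  have : p % 4 ≠ 0 := fun h0 ↦ by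
    have := Nat.isUnit_iff.1 (h.squarefree_left 2 (Nat.dvd_of_mod_eq_zero h0))
    omega
  omega

/-- In types (1) and (2), `r ≡ p` modulo `4`, so that `(r, q)` has the same type as `(p, q)` and the
smaller of `p` and `r` can be put first. -/
theorem exists_isOrderedTypePair_of_typeOne_or_typeTwo
    (h : IsRealBiquadraticPresentation K p q s t) (hT : IsTypeOne p q ∨ IsTypeTwo p q) :
    ∃ (p' q' : ℕ) (s' t' : K), IsRealBiquadraticPresentation K p' q' s' t' ∧
      IsOrderedTypePair p' q' := by
  obtain ⟨r, u, h1, h2, e1, e2, e3⟩ := h.exists_triple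
  rcases lt_or_gt_of_ne h1.left_ne_right with hlt | hlt
  · exact ⟨p, q, s, t, h, .inl ⟨hT, e1 ▸ hlt⟩⟩
  · have hr4 : r % 4 = p % 4 := by
      have hmod := h.third_mod_four (hT.elim (fun h ↦ by have := h.2; omega)
        (fun h ↦ by have := h.2; omega))
      rw [e1] at hmod
      rcases hT with ⟨hp, hq⟩ | ⟨hp | hp, hq⟩ <;> rw [hmod, hp, hq]
    refine ⟨r, q, u, t, h2.swap, .inl ⟨?_, ?_⟩⟩
    · simpa only [IsTypeOne, IsTypeTwo, hr4] using hT
    · rwa [thirdRadicand_comm, e3]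

theorem exists_isOrderedTypePair_of_one (h : IsRealBiquadraticPresentation K p q s t)
    (hp : p % 4 = 1) (hq : q % 4 = 1) :
    ∃ (p' q' : ℕ) (s' t' : K), IsRealBiquadraticPresentation K p' q' s' t' ∧
      IsOrderedTypePair p' q' := by
  have hr := h.third_mod_four (by omega)
  obtain ⟨r, u, h1, h2, e1, e2, e3⟩ := h.exists_triple
  rw [e1, hp, hq] at hr
  have n1 := h.left_ne_right
  have n2 := h1.left_ne_right
  have n3 := h2.left_ne_right
  have e1' : thirdRadicand q p = r := by rw [thirdRadicand_comm, e1]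
  have e2' : thirdRadicand r p = q := by rw [thirdRadicand_comm, e2]
  have e3' : thirdRadicand r q = p := by rw [thirdRadicand_comm, e3]
  rcases lt_or_gt_of_ne n1 with l1 | l1 <;> rcases lt_or_gt_of_ne n2 with l2 | l2 <;>
    rcases lt_or_gt_of_ne n3 with l3 | l3
  · exact ⟨p, q, s, t, h, isOrderedTypePair_of_one hp hq l1 (by omega)⟩
  · exact ⟨p, r, s, u, h1, isOrderedTypePair_of_one hp hr l2 (by omega)⟩
  · omega
  · exact ⟨r, p, u, s, h1.swap, isOrderedTypePair_of_one hr hp l2 (by omega)⟩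
  · exact ⟨q, p, t, s, h.swap, isOrderedTypePair_of_one hq hp l1 (by omega)⟩
  · omega
  · exact ⟨q, r, t, u, h2, isOrderedTypePair_of_one hq hr l3 (by omega)⟩
  · exact ⟨r, q, u, t, h2.swap, isOrderedTypePair_of_one hr hq l3 (by omega)⟩

theorem exists_isOrderedTypePair (h : IsRealBiquadraticPresentation K p q s t) :
    ∃ (p' q' : ℕ) (s' t' : K), IsRealBiquadraticPresentation K p' q' s' t' ∧
      IsOrderedTypePair p' q' := by
  rcases h.left_mod_four with hp | hp | hp <;> rcases h.swap.left_mod_four with hq | hq | hq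
  · exact h.exists_isOrderedTypePair_of_one hp hq
  · exact h.swap.exists_isOrderedTypePair_of_typeOne_or_typeTwo (.inr ⟨.inl hq, hp⟩)
  · exact h.swap.exists_isOrderedTypePair_of_typeOne_or_typeTwo (.inr ⟨.inr hq, hp⟩)
  · exact h.exists_isOrderedTypePair_of_typeOne_or_typeTwo (.inr ⟨.inl hp, hq⟩)
  · -- Here `p = ga` and `q = gb` with `g` even, so that `r = ab` is odd.
    obtain ⟨g, a, b, hg, hG, hp', hq', hr, -⟩ := h.exists_factorization
    have hg2 : 2 ∣ g := hG ▸ Nat.dvd_gcd (by omega) (by omega)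
    have hodd : thirdRadicand p q % 2 = 1 := by
      obtain ⟨k, rfl⟩ := hg2
      have ha : Odd (k * a) := Nat.odd_iff.2 (by rw [mul_assoc] at hp'; omega)
      have hb : Odd (k * b) := Nat.odd_iff.2 (by rw [mul_assoc] at hq'; omega)
      rw [hr, ← Nat.odd_iff]
      exact (Nat.odd_mul.1 ha).2.mul (Nat.odd_mul.1 hb).2
    have hr4 : thirdRadicand p q % 4 = 3 ∨ thirdRadicand p q % 4 = 1 := by omega
    exact h.third.exists_isOrderedTypePair_of_typeOne_or_typeTwo
      (hr4.imp (⟨hp, ·⟩) (⟨.inl hp, ·⟩))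
  · exact h.exists_isOrderedTypePair_of_typeOne_or_typeTwo (.inl ⟨hp, hq⟩)
  · exact h.exists_isOrderedTypePair_of_typeOne_or_typeTwo (.inr ⟨.inr hp, hq⟩)
  · exact h.swap.exists_isOrderedTypePair_of_typeOne_or_typeTwo (.inl ⟨hq, hp⟩)
  · have hr := h.third_mod_four (by omega)
    rw [hp, hq] at hr
    exact h.third.exists_isOrderedTypePair_of_typeOne_or_typeTwo (.inr ⟨.inr hp, hr⟩)

end IsRealBiquadraticPresentation

theorem theorem1p5 (K : Type*) [Field K] [NumberField K] :
    (IsRealBiquadratic K →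
      (quadraticSubfields K).ncard = 3 ∧
      2 ≤ {F ∈ quadraticSubfields K | IndecomposablesPersist F}.ncard) ∧
    (∀ (p q : ℕ) (s t : K), IsRealBiquadraticPresentation K p q s t →
      ((IsTypeOne p q ∨ IsTypeTwo p q) → p < thirdRadicand p q →
        IndecomposablesPersist (IntermediateField.adjoin ℚ {s}) ∧
        IndecomposablesPersist (IntermediateField.adjoin ℚ {t})) ∧
      ((IsTypeThree p q ∨ IsTypeFour p q) → p < q → q < thirdRadicand p q →
        IndecomposablesPersist (IntermediateField.adjoin ℚ {s}) ∧
        IndecomposablesPersist (IntermediateField.adjoin ℚ {t}))) := by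
  refine ⟨?_, fun p q s t h ↦ ⟨fun hT hlt ↦ h.persist_of_isOrderedTypePair (.inl ⟨hT, hlt⟩),
    fun hT h1 h2 ↦ h.persist_of_isOrderedTypePair (.inr ⟨hT, h1, h2⟩)⟩⟩
  rintro ⟨p₀, q₀, s₀, t₀, h₀⟩
  obtain ⟨p, q, s, t, h, hT⟩ := h₀.exists_isOrderedTypePair
  refine ⟨h.ncard_quadraticSubfields, ?_⟩
  have hfin : (quadraticSubfields K).Finite :=
    Set.finite_of_ncard_ne_zero (by rw [h.ncard_quadraticSubfields]; norm_num)
  rw [← Set.ncard_pair h.adjoin_left_ne_adjoin_right]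
  refine Set.ncard_le_ncard ?_ (hfin.subset fun F hF ↦ hF.1)
  obtain ⟨hs, ht⟩ := h.persist_of_isOrderedTypePair hT
  rintro F (rfl | rfl)
  exacts [⟨h.finrank_adjoin_left, hs⟩, ⟨h.swap.finrank_adjoin_left, ht⟩]
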